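/- For $u^{(q)}\in\mathbb{R}^{d_q}$ let $u^{(1)}\circ\cdots\circ u^{(p)}$ be the tensor with entries $\prod_q u^{(q)}_{i_q}$. For a real tensor $\mathscr{A}\in\mathbb{R}^{d_1\times\cdots\times d_p}$ let $$\|\mathscr{A}\|=\sup\{\langle \mathscr{A},u^{(1)}\circ\cdots\circ u^{(p)}\rangle : u^{(q)}\in\mathbb{R}^{d_q},\ \|u^{(q)}\|=1 \text{ for all } q\}$$ be its spectral norm, and let $\mathscr{A}\times_{s\ne q}u^{(s)}\in\mathbb{R}^{d_q}$ be the vector whose $j$-th entry is $\sum_{i:\,i_q=j}\mathscr{A}_{i_1\cdots i_p}\prod_{s\ne q}u^{(s)}_{i_s}$. Write $d_{\min}=\min_q d_q$. **Theorem 1.** For every $\varepsilon>0$ there is a constant $c_\varepsilon>0$, depending on $\varepsilon$ only, such that the following holds for all $p\ge 3$ and all $d_1,\dots,d_p$. Let $\mathscr{T}$ and $\mathscr{X}=\mathscr{T}+\mathscr{E}$ in $\mathbb{R}^{d_1\times\cdots\times d_p}$ both be orthogonally decomposable (odeco), with decompositions $$\mathscr{T}=\sum_{k=1}^{d_{\min}}\lambda_k\,u_k^{(1)}\circ\cdots\circ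 u_k^{(p)},\qquad \mathscr{X}=\sum_{k=1}^{d_{\min}}\hat\lambda_k\,\hat u_k^{(1)}\circ\cdots\circ \hat u_k^{(p)},$$ where $\lambda_k,\hat\lambda_k$ are real (possibly zero) and, for each $q$, the vectors $u_1^{(q)},\dots,u_{d_{\min}}^{(q)}$ are orthonormal, and so are $\hat u_1^{(q)},\dots,\hat u_{d_{\min}}^{(q)}$. Then there is a permutation $\pi$ of $\{1,\dots,d_{\min}\}$ such that for every $\varepsilon>0$ and every $k$ with $\lambda_k>0$ and $\|\mathscr{E}\|\le c_\varepsilon\lambda_k$, $$\max_{1\le q\le p}\ \sin\angle\Big(\hat u_{\pi(k)}^{(q)},\ u_k^{(q)}+\frac1{\lambda_k}\,\mathscr{E}\times_{s\ne q}u_k^{(s)}\Big)\ \le\ \Big(2+\frac{\|\mathscr{E}\|}{\lambda_k}\Big)\Big(\frac{(1+\varepsilon)\|\mathscr{E}\|}{\lambda_k}\Big)^{p-1}.$$ The permutation $\pi$ does not depend on $\varepsilon$. -/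

import Mathlib

/-- Real tensors of order `p` and format `d 0 × ⋯ × d (p-1)`, as arrays of entries. -/
abbrev RealTensor {p : ℕ} (d : Fin p → ℕ) : Type :=
  (∀ q : Fin p, Fin (d q)) → ℝ

namespace RealTensor

open Finset

/-- The outer product `u 0 ∘ u 1 ∘ ⋯ ∘ u (p-1)`. -/
def outer {p : ℕ} {d : Fin p → ℕ} (u : ∀ q, EuclideanSpace ℝ (Fin (d q))) : RealTensor d :=
  fun i => ∏ q, u q (i q)

/-- The entrywise inner product of two tensors. -/
def dot {p : ℕ} {d : Fin p → ℕ} (S T : RealTensor d) : ℝ :=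
  ∑ i, S i * T i

/-- The spectral norm: supremum of `⟨T, u 0 ∘ ⋯ ∘ u (p-1)⟩` over unit vectors. -/
noncomputable def spectralNorm {p : ℕ} {d : Fin p → ℕ} (T : RealTensor d) : ℝ :=
  sSup {x : ℝ | ∃ u : ∀ q, EuclideanSpace ℝ (Fin (d q)),
    (∀ q, ‖u q‖ = 1) ∧ x = dot T (outer u)}

/-- The vector `T ×_{s ≠ q} u s` in `ℝ^(d q)`: multiply `T` along every mode `s ≠ q` by `u s`.
The vector `u q` is not used. -/
noncomputable def contractExcept {p : ℕ} {d : Fin p → ℕ} (T : RealTensor d) (q : Fin p)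
    (u : ∀ s, EuclideanSpace ℝ (Fin (d s))) : EuclideanSpace ℝ (Fin (d q)) :=
  WithLp.toLp 2 fun j =>
    ∑ i : (∀ s : Fin p, Fin (d s)) with i q = j, T i * ∏ s ∈ univ.erase q, u s (i s)

/-- The smallest dimension `d_min`. -/
noncomputable def minDim {p : ℕ} (d : Fin p → ℕ) : ℕ :=
  ⨅ q, d q

/-- `T = ∑ k, lam k • U 0 k ∘ ⋯ ∘ U (p-1) k` is an orthogonal decomposition (SVD) of `T`, with
`d_min` terms (zero coefficients allowed), where for each mode `q` the vectors `U q k` are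
orthonormal. -/
structure IsOdecoSVD {p : ℕ} {d : Fin p → ℕ} (T : RealTensor d) (lam : Fin (minDim d) → ℝ)
    (U : ∀ q : Fin p, Fin (minDim d) → EuclideanSpace ℝ (Fin (d q))) : Prop where
  orthonormal : ∀ q, Orthonormal ℝ (U q)
  eq_sum : T = ∑ k, lam k • outer (fun q => U q k)

end RealTensor

namespace RealTensor

open Finset

/-! ### Scalar inequalities for the overlaps. -/

section Reals

variable {p : ℕ} {y : Fin p → ℝ} {m δ M B : ℝ}

/-! Fix `k` and put `δ = ‖E‖ / lam k`, `μ l = lam' l / lam k`, `x l s = ⟨U' s l, U s k⟩`.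
Contracting `X = T + E` along the `U s k` shows that the target vector is exactly `∑ l, (μ l * ∏_{s
≠ q} x l s) • U' q l`, so the sine only sees the coefficients with `l ≠ π k`. Contracting along the
`U' s l` as well gives `μ l * x l q ≈ ∏_{s ≠ q} x l s` and `μ l * ∏_{s ≠ q} x l s ≈ x l q`, up to
`δ`. These force the overlaps of each `l` to be all `O(δ)` or all near `1` in modulus
(`overlap_dichotomy`); exactly one `l` is of the second kind and defines the matching. For the
others, each coefficient is a product of `p - 1` factors, `μ l` being absorbed into one of them, and
each factor is about `δ`. Bessel's inequality makes this uniform in the number of terms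
(`sum_erase_sq_le`). -/

lemma abs_prod_erase_le_sq (hp : 3 ≤ p) (hM : M ≤ 1) (hy : ∀ s, |y s| ≤ M) (q : Fin p) :
    |∏ s ∈ univ.erase q, y s| ≤ M ^ 2 := by
  have hM0 : 0 ≤ M := (abs_nonneg _).trans (hy q)
  rw [abs_prod]
  calc ∏ s ∈ univ.erase q, |y s| ≤ ∏ _s ∈ univ.erase q, M :=
        prod_le_prod (fun _ _ => abs_nonneg _) (fun s _ => hy s)
    _ = M ^ (p - 1) := by simp
    _ ≤ M ^ 2 := pow_le_pow_of_le_one hM0 hM (by omega)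

lemma abs_mul_le_of_abs_sub_prod_erase_le (hp : 3 ≤ p) (hM : M ≤ 1) (hy : ∀ s, |y s| ≤ M)
    (hA : ∀ q, |m * y q - ∏ s ∈ univ.erase q, y s| ≤ δ) (q : Fin p) :
    |m * y q| ≤ δ + M ^ 2 := by
  have h1 := abs_prod_erase_le_sq hp hM hy q
  have h2 := hA q
  have h3 := abs_add_le (m * y q - ∏ s ∈ univ.erase q, y s) (∏ s ∈ univ.erase q, y s)
  rw [sub_add_cancel] at h3
  linarith

/-- There is no bound on `m` alone, so it is paired with one factor `y r`. The factor `y s` is kept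
apart so that it can later be summed in square over `l`. -/
lemma abs_mul_prod_erase_le (hp : 3 ≤ p) (hy : ∀ s, |y s| ≤ M) (hB : ∀ s, |m * y s| ≤ B)
    {q s : Fin p} (hs : s ≠ q) :
    |m * ∏ t ∈ univ.erase q, y t| ≤ B * M ^ (p - 3) * |y s| := by
  have hM0 : 0 ≤ M := (abs_nonneg _).trans (hy q)
  have hcard : ((univ.erase q).erase s).card = p - 2 := by
    rw [card_erase_of_mem (by simp [hs]), card_erase_of_mem (mem_univ _)]
    simp
    omega
  obtain ⟨r, hr⟩ : ((univ.erase q).erase s).Nonempty := by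
    rw [← card_pos]
    omega
  have hcard' : (((univ.erase q).erase s).erase r).card = p - 3 := by
    rw [card_erase_of_mem hr]
    omega
  rw [← mul_prod_erase _ _ (show s ∈ univ.erase q by simp [hs]), ← mul_prod_erase _ _ hr]
  have h1 : |∏ t ∈ ((univ.erase q).erase s).erase r, y t| ≤ M ^ (p - 3) := by
    rw [abs_prod, ← hcard', ← prod_const]
    exact prod_le_prod (fun _ _ => abs_nonneg _) (fun t _ => hy t)
  rw [show m * (y s * (y r * ∏ t ∈ ((univ.erase q).erase s).erase r, y t)) =
    (m * y r) * (∏ t ∈ ((univ.erase q).erase s).erase r, y t) * y s by ring, abs_mul, abs_mul]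
  have hB0 : 0 ≤ B := (abs_nonneg _).trans (hB q)
  gcongr
  exact hB r

/-- Overlaps in all modes are either all tiny or all large. -/
lemma overlap_dichotomy (hp : 3 ≤ p) (hδ : δ ≤ 1 / 100) (hy : ∀ s, |y s| ≤ 1)
    (hA : ∀ q, |m * y q - ∏ s ∈ univ.erase q, y s| ≤ δ)
    (hB : ∀ q, |m * ∏ s ∈ univ.erase q, y s - y q| ≤ δ) :
    (∀ q, |y q| ≤ 2 * δ) ∨ ∀ q, 4 / 5 < |y q| := by
  have : Nonempty (Fin p) := ⟨⟨0, by omega⟩⟩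
  obtain ⟨q, hq⟩ := Finite.exists_max fun s => |y s|
  have hM0 : 0 ≤ |y q| := abs_nonneg _
  have hM1 := hy q
  obtain ⟨s, hs⟩ : ∃ s : Fin p, s ≠ q := by
    have : Nontrivial (Fin p) := Fin.nontrivial_iff_two_le.2 (by omega)
    exact exists_ne q
  have hy' (q : Fin p) : |y q| ≤ δ + |m * ∏ s ∈ univ.erase q, y s| := by
    have h2 := hB q
    have h3 := abs_sub (m * ∏ s ∈ univ.erase q, y s) (m * ∏ s ∈ univ.erase q, y s - y q)
    rw [sub_sub_cancel] at h3
    linarith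
  have hmy := abs_mul_le_of_abs_sub_prod_erase_le hp hM1 hq hA
  have hδ0 : 0 ≤ δ := (abs_nonneg _).trans (hA q)
  have h1 : |m * ∏ t ∈ univ.erase q, y t| ≤ (δ + |y q| ^ 2) * |y q| := by
    refine (abs_mul_prod_erase_le hp hq hmy hs).trans ?_
    refine mul_le_mul ?_ (hq s) (abs_nonneg _) (by positivity)
    exact mul_le_of_le_one_right (by positivity) (pow_le_one₀ hM0 hM1)
  have h2 := hy' q
  -- The maximum `M = |y q|` satisfies `M ≤ δ + (δ + M ^ 2) * M`. Were `M * (1 - M) > δ`,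
  -- multiplying by `1 + M` would contradict this.
  have h3 : |y q| * (1 - |y q|) ≤ δ := by
    by_contra h
    push Not at h
    nlinarith
  rcases le_total |y q| (1 / 2) with h | h
  · left
    intro t
    have := hq t
    nlinarith
  · right
    have h4 : 98 / 100 ≤ |y q| := by nlinarith
    have h5 := hmy q
    rw [abs_mul] at h5
    have h6 : |m| ≤ 104 / 100 := by nlinarith [abs_nonneg m]
    rw [abs_mul] at h2
    -- All factors are at most `1` in modulus, so a lower bound on the product bounds each factor
    -- from below.
    have h7 : 9 / 10 ≤ |∏ t ∈ univ.erase q, y t| := by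
      nlinarith [abs_nonneg (∏ t ∈ univ.erase q, y t)]
    intro t
    by_cases ht : t = q
    · rw [ht]
      linarith
    · rw [← mul_prod_erase _ _ (show t ∈ univ.erase q by simp [ht]), abs_mul, abs_prod] at h7
      have : ∏ i ∈ (univ.erase q).erase t, |y i| ≤ 1 :=
        prod_le_one (fun _ _ => abs_nonneg _) (fun i _ => hy i)
      nlinarith [abs_nonneg (y t)]

/-- Sharp estimates when all overlaps are tiny. -/
lemma small_overlap_bounds (hp : 3 ≤ p) {ε : ℝ} (hδ : δ ≤ 1 / 100) (hδε : δ ≤ ε / 8)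
    (hy : ∀ q, |y q| ≤ 2 * δ)
    (hA : ∀ q, |m * y q - ∏ s ∈ univ.erase q, y s| ≤ δ)
    (hB : ∀ q, |m * ∏ s ∈ univ.erase q, y s - y q| ≤ δ) :
    (∀ q, |y q| ≤ (1 + ε) * δ) ∧ ∀ q, |m * y q| ≤ (1 + ε) * δ := by
  have hδ0 : 0 ≤ δ := (abs_nonneg _).trans (hA ⟨0, by omega⟩)
  have hmy := abs_mul_le_of_abs_sub_prod_erase_le hp (by linarith) hy hA
  refine ⟨fun q => ?_, fun q => (hmy q).trans (by nlinarith)⟩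
  obtain ⟨s, hs⟩ : ∃ s : Fin p, s ≠ q := by
    have : Nontrivial (Fin p) := Fin.nontrivial_iff_two_le.2 (by omega)
    exact exists_ne q
  have h1 : |m * ∏ t ∈ univ.erase q, y t| ≤ (δ + (2 * δ) ^ 2) * (2 * δ) := by
    refine (abs_mul_prod_erase_le hp hy hmy hs).trans ?_
    gcongr
    · exact mul_le_of_le_one_right (by positivity) (pow_le_one₀ (by linarith) (by linarith))
    · exact hy s
  have h2 := hB q
  have h3 := abs_sub (m * ∏ s ∈ univ.erase q, y s) (m * ∏ s ∈ univ.erase q, y s - y q)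
  rw [sub_sub_cancel] at h3
  have h4 : (δ + (2 * δ) ^ 2) * (2 * δ) ≤ ε * δ := by
    have : (δ + (2 * δ) ^ 2) * 2 ≤ ε := by nlinarith
    nlinarith
  linarith

variable {ι : Type*} [Fintype ι] {x : ι → Fin p → ℝ} {μ : ι → ℝ}

/-- If every `l` were on the tiny side of the dichotomy, the sum in `hC` would be at most `1 / 5`,
by AM-GM and Bessel. -/
lemma exists_large_overlap (hp : 3 ≤ p) (hδ : δ ≤ 1 / 100)
    (hx : ∀ s, ∑ l, x l s ^ 2 ≤ 1)
    (hA : ∀ l q, |μ l * x l q - ∏ s ∈ univ.erase q, x l s| ≤ δ)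
    (hB : ∀ l q, |μ l * ∏ s ∈ univ.erase q, x l s - x l q| ≤ δ)
    (q : Fin p) (hC : 1 - δ ≤ ∑ l, (μ l * ∏ s ∈ univ.erase q, x l s) * x l q) :
    ∃ l, ∀ s, 4 / 5 < |x l s| := by
  by_contra! hcon
  have hx1 (l s) : |x l s| ≤ 1 := by
    rw [← sq_le_one_iff_abs_le_one]
    exact (single_le_sum (f := fun l => x l s ^ 2) (fun _ _ => sq_nonneg _) (mem_univ l)).trans
      (hx s)
  have hsmall (l) : ∀ s, |x l s| ≤ 2 * δ := by
    rcases overlap_dichotomy hp hδ (hx1 l) (hA l) (hB l) with h | h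
    · exact h
    · obtain ⟨s, hs⟩ := hcon l
      exact absurd (h s) (not_lt.2 hs)
  obtain ⟨s, hs⟩ : ∃ s : Fin p, s ≠ q := by
    have : Nontrivial (Fin p) := Fin.nontrivial_iff_two_le.2 (by omega)
    exact exists_ne q
  have hterm (l) : (μ l * ∏ s ∈ univ.erase q, x l s) * x l q ≤
      1 / 10 * (x l s ^ 2 + x l q ^ 2) := by
    have hδ0 : 0 ≤ δ := (abs_nonneg _).trans (hA l q)
    have hmy := abs_mul_le_of_abs_sub_prod_erase_le hp (by linarith) (hsmall l) (hA l)
    have h1 : |μ l * ∏ t ∈ univ.erase q, x l t| ≤ 1 / 10 * |x l s| := by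
      refine (abs_mul_prod_erase_le hp (hsmall l) hmy hs).trans ?_
      gcongr
      refine (mul_le_of_le_one_right (by positivity)
        (pow_le_one₀ (by linarith) (by linarith))).trans (by nlinarith)
    refine (le_abs_self _).trans ?_
    rw [abs_mul, ← sq_abs (x l s), ← sq_abs (x l q)]
    nlinarith [abs_nonneg (x l s), abs_nonneg (x l q), sq_nonneg (|x l s| - |x l q|)]
  have := sum_le_sum fun l (_ : l ∈ univ) => hterm l
  rw [← mul_sum, sum_add_distrib] at this
  linarith [hx s, hx q]

/-- The part of the contracted tensor orthogonal to the matched direction is of order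
`δ ^ (p - 1)`. -/
lemma sum_erase_sq_le [DecidableEq ι] (hp : 3 ≤ p) {ε : ℝ} (hε : 0 < ε) (hε1 : ε ≤ 1)
    (hδ : δ ≤ 1 / 100) (hδε : δ ≤ ε / 8)
    (hx : ∀ s, ∑ l, x l s ^ 2 ≤ 1)
    (hA : ∀ l q, |μ l * x l q - ∏ s ∈ univ.erase q, x l s| ≤ δ)
    (hD : ∀ q, ∑ l, (μ l * ∏ s ∈ univ.erase q, x l s - x l q) ^ 2 ≤ δ ^ 2)
    {k : ι} (hk : ∀ l ≠ k, ∀ s, |x l s| ≤ 2 * δ) (q : Fin p) :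
    ∑ l ∈ univ.erase k, (μ l * ∏ s ∈ univ.erase q, x l s) ^ 2 ≤
      (3 / 2 * ((1 + ε) * δ) ^ (p - 1)) ^ 2 := by
  have hδ0 : 0 ≤ δ := (abs_nonneg _).trans (hA k q)
  have hB (l q) : |μ l * ∏ s ∈ univ.erase q, x l s - x l q| ≤ δ := by
    refine abs_le_of_sq_le_sq ?_ hδ0
    exact (single_le_sum (f := fun l => (μ l * ∏ s ∈ univ.erase q, x l s - x l q) ^ 2)
      (fun _ _ => sq_nonneg _) (mem_univ l)).trans (hD q)
  set G := (1 + ε) * δ with hG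
  have hG0 : 0 ≤ G := by positivity
  have hG2 : G ≤ 2 * δ := by nlinarith
  have hδG : δ ≤ G := by nlinarith
  have hex (q : Fin p) : ∃ s : Fin p, s ≠ q := by
    have : Nontrivial (Fin p) := Fin.nontrivial_iff_two_le.2 (by omega)
    exact exists_ne q
  have hterm {q s : Fin p} (hs : s ≠ q) : ∑ l ∈ univ.erase k,
      (μ l * ∏ s ∈ univ.erase q, x l s) ^ 2 ≤
        (G ^ (p - 2)) ^ 2 * ∑ l ∈ univ.erase k, x l s ^ 2 := by
    rw [mul_sum]
    refine sum_le_sum fun l hl => ?_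
    obtain ⟨h1, h2⟩ := small_overlap_bounds hp hδ hδε (hk l (ne_of_mem_erase hl)) (hA l) (hB l)
    have h3 := abs_mul_prod_erase_le hp h1 h2 hs
    rw [← hG, ← pow_succ', show p - 3 + 1 = p - 2 by omega] at h3
    rw [← mul_pow, ← sq_abs, ← sq_abs (G ^ (p - 2) * x l s), abs_mul (G ^ (p - 2)),
      abs_of_nonneg (pow_nonneg hG0 _)]
    gcongr
  -- Bootstrap: a bound `C` valid in all modes improves itself, since `x l q` is `μ l * ∏ x l s` up
  -- to an error of `ℓ²` norm at most `δ`. Starting from `C = 1`, two rounds give `10 * δ ^ 2` and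
  -- then `2 * δ ^ 2 + 80 * δ ^ 4`.
  have himp {C : ℝ} (hC : ∀ s, ∑ l ∈ univ.erase k, x l s ^ 2 ≤ C) (q : Fin p) :
      ∑ l ∈ univ.erase k, x l q ^ 2 ≤ 2 * δ ^ 2 + 8 * δ ^ 2 * C := by
    obtain ⟨s, hs⟩ := hex q
    have hC0 : 0 ≤ C := (sum_nonneg fun _ _ => sq_nonneg _).trans (hC q)
    have h1 : ∑ l ∈ univ.erase k, (μ l * ∏ s ∈ univ.erase q, x l s) ^ 2 ≤ (2 * δ) ^ 2 * C := by
      refine (hterm hs).trans ?_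
      have : G ^ (p - 2) ≤ 2 * δ :=
        (pow_le_of_le_one hG0 (by linarith) (by omega)).trans hG2
      gcongr
      exact hC s
    have h2 : ∑ l ∈ univ.erase k, (μ l * ∏ s ∈ univ.erase q, x l s - x l q) ^ 2 ≤ δ ^ 2 :=
      (sum_le_sum_of_subset_of_nonneg (erase_subset _ _) fun _ _ _ => sq_nonneg _).trans (hD q)
    have h3 : ∑ l ∈ univ.erase k, x l q ^ 2 ≤ ∑ l ∈ univ.erase k,
        (2 * (μ l * ∏ s ∈ univ.erase q, x l s - x l q) ^ 2 +
          2 * (μ l * ∏ s ∈ univ.erase q, x l s) ^ 2) := by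
      refine sum_le_sum fun l _ => ?_
      nlinarith [sq_nonneg (2 * (μ l * ∏ s ∈ univ.erase q, x l s) - x l q)]
    rw [sum_add_distrib, ← mul_sum, ← mul_sum] at h3
    linarith
  have h1 := himp (C := 1) fun s =>
    (sum_le_sum_of_subset_of_nonneg (erase_subset _ _) fun _ _ _ => sq_nonneg _).trans (hx s)
  obtain ⟨s, hs⟩ := hex q
  have h2 : ∑ l ∈ univ.erase k, x l s ^ 2 ≤ (3 / 2 * G) ^ 2 := by
    refine (himp h1 s).trans ?_
    have : δ ^ 2 ≤ (1 / 100) ^ 2 := by gcongr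
    have : δ ^ 2 ≤ G ^ 2 := by gcongr
    nlinarith
  refine (hterm hs).trans ?_
  rw [show p - 1 = p - 2 + 1 by omega, pow_succ G,
    show (3 / 2 * (G ^ (p - 2) * G)) ^ 2 = (G ^ (p - 2)) ^ 2 * (3 / 2 * G) ^ 2 by ring]
  gcongr

end Reals

lemma sum_sq_inner_le {ι F : Type*} [Fintype ι] [NormedAddCommGroup F] [InnerProductSpace ℝ F]
    {v : ι → F} (hv : Orthonormal ℝ v) (w : F) : ∑ i, inner ℝ (v i) w ^ 2 ≤ ‖w‖ ^ 2 := by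
  simpa using hv.sum_inner_products_le (s := univ) w

/-- Both sides are the norm of the component orthogonal to the unit vector `v k`. -/
lemma sin_angle_mul_norm_of_eq_sum {ι F : Type*} [Fintype ι] [DecidableEq ι]
    [NormedAddCommGroup F] [InnerProductSpace ℝ F] {v : ι → F} (hv : Orthonormal ℝ v) (a : ι → ℝ)
    (k : ι) :
    Real.sin (InnerProductGeometry.angle (v k) (∑ l, a l • v l)) * ‖∑ l, a l • v l‖ =
      √(∑ l ∈ univ.erase k, a l ^ 2) := by
  have h := InnerProductGeometry.sin_angle_mul_norm_mul_norm (v k) (∑ l, a l • v l)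
  rw [hv.norm_eq_one, one_mul] at h
  rw [h, hv.inner_right_fintype, hv.inner_sum, real_inner_self_eq_norm_sq, hv.norm_eq_one,
    ← add_sum_erase _ _ (mem_univ k)]
  simp [sq]

/-! ### Contractions of tensors and the spectral norm. -/

section Tensor

variable {p : ℕ} {d : Fin p → ℕ}

lemma dot_add_left (S T R : RealTensor d) : dot (S + T) R = dot S R + dot T R := by
  simp [dot, add_mul, sum_add_distrib]

lemma dot_outer_outer (u w : ∀ q, EuclideanSpace ℝ (Fin (d q))) :
    dot (outer u) (outer w) = ∏ q, inner ℝ (u q) (w q) := by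
  simp only [dot, outer, ← prod_mul_distrib, PiLp.inner_apply, prod_univ_sum,
    Fintype.piFinset_univ]
  simp [mul_comm]

lemma inner_contractExcept (T : RealTensor d) (q : Fin p)
    (u : ∀ s, EuclideanSpace ℝ (Fin (d s))) (w : EuclideanSpace ℝ (Fin (d q))) :
    inner ℝ (contractExcept T q u) w = dot T (outer (Function.update u q w)) := by
  have hprod (i : ∀ s, Fin (d s)) : outer (Function.update u q w) i =
      w (i q) * ∏ s ∈ univ.erase q, u s (i s) := by
    rw [outer, ← mul_prod_erase _ _ (mem_univ q), Function.update_self]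
    congr 1
    refine prod_congr rfl fun s hs => ?_
    rw [Function.update_of_ne (ne_of_mem_erase hs)]
  simp only [dot, hprod, PiLp.inner_apply, contractExcept]
  rw [← sum_fiberwise (s := univ) (g := fun i : ∀ s, Fin (d s) => i q)]
  refine sum_congr rfl fun j _ => ?_
  simp only [RCLike.inner_apply, conj_trivial, mul_sum]
  refine sum_congr rfl fun i hi => ?_
  rw [(mem_filter.1 hi).2]
  ring

lemma contractExcept_add (S T : RealTensor d) (q : Fin p)
    (u : ∀ s, EuclideanSpace ℝ (Fin (d s))) :
    contractExcept (S + T) q u = contractExcept S q u + contractExcept T q u := by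
  refine ext_inner_right ℝ fun w => ?_
  simp only [inner_add_left, inner_contractExcept, dot_add_left]

lemma IsOdecoSVD.contractExcept_eq_sum {T : RealTensor d} {lam : Fin (minDim d) → ℝ}
    {U : ∀ q : Fin p, Fin (minDim d) → EuclideanSpace ℝ (Fin (d q))} (h : IsOdecoSVD T lam U)
    (q : Fin p) (u : ∀ s, EuclideanSpace ℝ (Fin (d s))) :
    contractExcept T q u =
      ∑ l, (lam l * ∏ s ∈ univ.erase q, inner ℝ (U s l) (u s)) • U q l := by
  refine ext_inner_right ℝ fun w => ?_
  have hdot (R : RealTensor d) : dot T R = ∑ l, lam l * dot (outer fun q => U q l) R := by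
    rw [h.eq_sum]
    simp only [dot, Finset.sum_apply, Pi.smul_apply, smul_eq_mul, sum_mul, mul_sum]
    rw [sum_comm]
    simp only [mul_assoc]
  rw [inner_contractExcept, hdot, sum_inner]
  refine sum_congr rfl fun l _ => ?_
  rw [dot_outer_outer, ← mul_prod_erase _ _ (mem_univ q), Function.update_self,
    real_inner_smul_left, mul_comm (inner ℝ (U q l) w), mul_assoc]
  congr 2
  refine prod_congr rfl fun s hs => ?_
  rw [Function.update_of_ne (ne_of_mem_erase hs)]

lemma IsOdecoSVD.contractExcept_self (hp : 2 ≤ p) {T : RealTensor d} {lam : Fin (minDim d) → ℝ}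
    {U : ∀ q : Fin p, Fin (minDim d) → EuclideanSpace ℝ (Fin (d q))} (h : IsOdecoSVD T lam U)
    (q : Fin p) (k : Fin (minDim d)) :
    contractExcept T q (fun s => U s k) = lam k • U q k := by
  rw [h.contractExcept_eq_sum, sum_eq_single k]
  · rw [prod_eq_one, mul_one]
    intro s _
    rw [real_inner_self_eq_norm_sq, (h.orthonormal s).norm_eq_one, one_pow]
  · intro l _ hl
    obtain ⟨s, hs⟩ : ∃ s : Fin p, s ≠ q := by
      have : Nontrivial (Fin p) := Fin.nontrivial_iff_two_le.2 hp
      exact exists_ne q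
    rw [prod_eq_zero (i := s) (by simp [hs]) ((h.orthonormal s).inner_eq_zero hl), mul_zero,
      zero_smul]
  · simp

lemma dot_outer_le_spectralNorm (E : RealTensor d) (u : ∀ q, EuclideanSpace ℝ (Fin (d q)))
    (hu : ∀ q, ‖u q‖ = 1) : dot E (outer u) ≤ spectralNorm E := by
  refine le_csSup ⟨∑ i, |E i|, ?_⟩ ⟨u, hu, rfl⟩
  rintro _ ⟨w, hw, rfl⟩
  refine sum_le_sum fun i _ => (le_abs_self _).trans ?_
  rw [abs_mul, outer, abs_prod]
  refine mul_le_of_le_one_right (abs_nonneg _) (prod_le_one (fun _ _ => abs_nonneg _) ?_)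
  intro q _
  exact (PiLp.norm_apply_le (w q) (i q)).trans (hw q).le

/-- Negating one vector negates the pairing, so the supremum dominates a number and its opposite. -/
lemma spectralNorm_nonneg (hp : 0 < p) (E : RealTensor d)
    (u : ∀ q, EuclideanSpace ℝ (Fin (d q))) (hu : ∀ q, ‖u q‖ = 1) : 0 ≤ spectralNorm E := by
  have h1 := dot_outer_le_spectralNorm E u hu
  have h2 := dot_outer_le_spectralNorm E (Function.update u ⟨0, hp⟩ (-u ⟨0, hp⟩)) fun q => by
    by_cases hq : q = ⟨0, hp⟩
    · subst hq
      simp [hu]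
    · simp [hq, hu]
  rw [← inner_contractExcept, inner_neg_right, inner_contractExcept, Function.update_eq_self] at h2
  linarith

lemma norm_contractExcept_le (E : RealTensor d) (q : Fin p)
    (u : ∀ s, EuclideanSpace ℝ (Fin (d s))) (hu : ∀ s, ‖u s‖ = 1) :
    ‖contractExcept E q u‖ ≤ spectralNorm E := by
  by_cases h0 : contractExcept E q u = 0
  · rw [h0, norm_zero]
    exact spectralNorm_nonneg (Nat.zero_lt_of_lt q.2) E u hu
  -- Test against the normalised contraction itself in mode `q`.
  · have h := dot_outer_le_spectralNorm E
      (Function.update u q (‖contractExcept E q u‖⁻¹ • contractExcept E q u)) fun s => by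
        by_cases hs : s = q
        · subst hs
          simp [norm_smul, h0]
        · simp [hs, hu]
    have hn : ‖contractExcept E q u‖ ≠ 0 := by simpa using h0
    rwa [← inner_contractExcept, real_inner_smul_right, real_inner_self_eq_norm_sq, sq,
      inv_mul_cancel_left₀ hn] at h

/-! ### Overlap relations between the two decompositions, and the matching. -/

section Perturbation

variable {T X E : RealTensor d} {lam lam' : Fin (minDim d) → ℝ}
  {U U' : ∀ q : Fin p, Fin (minDim d) → EuclideanSpace ℝ (Fin (d q))} {k : Fin (minDim d)}

lemma add_smul_contractExcept_eq_sum (hp : 2 ≤ p) (hT : IsOdecoSVD T lam U)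
    (hX : IsOdecoSVD X lam' U') (hE : X = T + E) (hk : lam k ≠ 0) (q : Fin p) :
    U q k + (lam k)⁻¹ • contractExcept E q (fun s => U s k) =
      ∑ l, (lam' l / lam k * ∏ s ∈ univ.erase q, inner ℝ (U' s l) (U s k)) • U' q l := by
  have h1 := hX.contractExcept_eq_sum q (fun s => U s k)
  rw [hE, contractExcept_add, hT.contractExcept_self hp] at h1
  have h2 := congrArg (fun v => (lam k)⁻¹ • v) h1
  simp only [smul_add, smul_smul, inv_mul_cancel₀ hk, one_smul, smul_sum] at h2
  rw [h2]
  refine sum_congr rfl fun l _ => ?_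
  congr 1
  ring

/-- Contract `X = T + E` along the `U' s l` and take the component along `U q k`. -/
lemma abs_overlap_sub_prod_le (hp : 2 ≤ p) (hT : IsOdecoSVD T lam U)
    (hX : IsOdecoSVD X lam' U') (hE : X = T + E) (hk : 0 < lam k) (l : Fin (minDim d))
    (q : Fin p) :
    |lam' l / lam k * inner ℝ (U' q l) (U q k) -
      ∏ s ∈ univ.erase q, inner ℝ (U' s l) (U s k)| ≤ spectralNorm E / lam k := by
  have h1 := hX.contractExcept_self hp q l
  rw [hE, contractExcept_add, hT.contractExcept_eq_sum] at h1
  have h2 := congrArg (fun v => inner ℝ v (U q k)) h1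
  simp only [inner_add_left, (hT.orthonormal q).inner_left_fintype, real_inner_smul_left,
    conj_trivial] at h2
  have h3 : |inner ℝ (contractExcept E q fun s => U' s l) (U q k)| ≤ spectralNorm E := by
    refine (abs_real_inner_le_norm _ _).trans ?_
    rw [(hT.orthonormal q).norm_eq_one, mul_one]
    exact norm_contractExcept_le _ _ _ fun s => (hX.orthonormal s).norm_eq_one l
  have h4 : lam' l / lam k * inner ℝ (U' q l) (U q k) -
      ∏ s ∈ univ.erase q, inner ℝ (U' s l) (U s k) =
        inner ℝ (contractExcept E q fun s => U' s l) (U q k) / lam k := by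
    simp only [real_inner_comm (U' _ l)] at h2
    rw [eq_div_iff hk.ne', sub_mul, mul_right_comm, div_mul_cancel₀ _ hk.ne']
    linarith
  rw [h4, abs_div, abs_of_pos hk]
  gcongr

/-- The differences are the `U' q l` coordinates of the contracted error divided by `lam k`, so
Bessel bounds them all at once. -/
lemma sum_sq_prod_sub_overlap_le (hp : 2 ≤ p) (hT : IsOdecoSVD T lam U)
    (hX : IsOdecoSVD X lam' U') (hE : X = T + E) (hk : 0 < lam k) (q : Fin p) :
    ∑ l, (lam' l / lam k * ∏ s ∈ univ.erase q, inner ℝ (U' s l) (U s k) -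
      inner ℝ (U' q l) (U q k)) ^ 2 ≤ (spectralNorm E / lam k) ^ 2 := by
  have h1 := add_smul_contractExcept_eq_sum hp hT hX hE hk.ne' q
  have h2 (l) : lam' l / lam k * ∏ s ∈ univ.erase q, inner ℝ (U' s l) (U s k) -
      inner ℝ (U' q l) (U q k) =
        inner ℝ (U' q l) ((lam k)⁻¹ • contractExcept E q (fun s => U s k)) := by
    rw [← add_sub_cancel_left (U q k) ((lam k)⁻¹ • contractExcept E q (fun s => U s k)), h1,
      inner_sub_right, (hX.orthonormal q).inner_right_fintype]
  simp only [h2]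
  refine (sum_sq_inner_le (hX.orthonormal q) _).trans ?_
  rw [norm_smul, norm_inv, Real.norm_of_nonneg hk.le, inv_mul_eq_div]
  have := norm_contractExcept_le E q (fun s => U s k) fun s => (hT.orthonormal s).norm_eq_one k
  gcongr

lemma one_sub_le_sum_prod_overlap (hp : 2 ≤ p) (hT : IsOdecoSVD T lam U)
    (hX : IsOdecoSVD X lam' U') (hE : X = T + E) (hk : 0 < lam k) (q : Fin p) :
    1 - spectralNorm E / lam k ≤ ∑ l, (lam' l / lam k *
      ∏ s ∈ univ.erase q, inner ℝ (U' s l) (U s k)) * inner ℝ (U' q l) (U q k) := by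
  have h1 := congrArg (fun v => inner ℝ v (U q k))
    (add_smul_contractExcept_eq_sum hp hT hX hE hk.ne' q)
  simp only [sum_inner, real_inner_smul_left, inner_add_left, real_inner_self_eq_norm_sq,
    (hT.orthonormal q).norm_eq_one] at h1
  rw [← h1]
  have h3 : |inner ℝ (contractExcept E q fun s => U s k) (U q k)| ≤ spectralNorm E := by
    refine (abs_real_inner_le_norm _ _).trans ?_
    rw [(hT.orthonormal q).norm_eq_one, mul_one]
    exact norm_contractExcept_le _ _ _ fun s => (hT.orthonormal s).norm_eq_one k
  rw [inv_mul_eq_div]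
  have h4 : -(spectralNorm E / lam k) ≤
      inner ℝ (contractExcept E q fun s => U s k) (U q k) / lam k := by
    rw [← neg_div]
    gcongr
    exact (abs_le.1 h3).1
  linarith

lemma one_sub_le_norm_add_smul_contractExcept (hT : IsOdecoSVD T lam U) (hk : 0 < lam k)
    (q : Fin p) : 1 - spectralNorm E / lam k ≤
      ‖U q k + (lam k)⁻¹ • contractExcept E q (fun s => U s k)‖ := by
  have h := norm_sub_le_norm_add (U q k) ((lam k)⁻¹ • contractExcept E q (fun s => U s k))
  rw [norm_smul, norm_inv, Real.norm_of_nonneg hk.le, inv_mul_eq_div,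
    (hT.orthonormal q).norm_eq_one] at h
  have h2 : ‖contractExcept E q (fun s => U s k)‖ / lam k ≤ spectralNorm E / lam k := by
    have := norm_contractExcept_le E q (fun s => U s k) fun s => (hT.orthonormal s).norm_eq_one k
    gcongr
  linarith

/-- Two distinct indices would violate Bessel, as `2 * (4 / 5) ^ 2 > 1`. -/
lemma eq_of_large_overlap {ι F : Type*} [Fintype ι] [NormedAddCommGroup F]
    [InnerProductSpace ℝ F] {v : ι → F} (hv : Orthonormal ℝ v) {w : F} (hw : ‖w‖ = 1) {i j : ι}
    (hi : 4 / 5 < |inner ℝ (v i) w|) (hj : 4 / 5 < |inner ℝ (v j) w|) : i = j := by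
  classical
  by_contra hij
  have h1 := sum_sq_inner_le hv w
  have h2 : ∑ l ∈ {i, j}, inner ℝ (v l) w ^ 2 ≤ ∑ l, inner ℝ (v l) w ^ 2 :=
    sum_le_sum_of_subset_of_nonneg (subset_univ _) fun _ _ _ => sq_nonneg _
  rw [sum_pair hij, ← sq_abs, ← sq_abs (inner ℝ (v j) w)] at h2
  rw [hw] at h1
  nlinarith

/-- If each index with a large coefficient has a matching index, the matching extends to a
permutation. -/
lemma exists_perm_matching {n : ℕ} {P : Fin n → Prop} {R : Fin n → Fin n → Prop}
    (hex : ∀ k, P k → ∃ l, R k l) (hinj : ∀ k k' l, R k l → R k' l → k = k') :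
    ∃ π : Equiv.Perm (Fin n), ∀ k, P k → R k (π k) := by
  classical
  choose! f hf using hex
  obtain ⟨π, hπ⟩ := Set.MapsTo.exists_equiv_extend_of_card_eq (α := Fin n) (t := univ)
    (s := {k | P k}) (f := f) (by simp) (by simp) (by
      intro a ha b hb hab
      exact hinj a b (f a) (hf a ha) (hab ▸ hf b hb))
  refine ⟨π.trans (Equiv.subtypeUnivEquiv (by simp)), fun k hk => ?_⟩
  simp only [Equiv.trans_apply, Equiv.subtypeUnivEquiv_apply, hπ k hk]
  exact hf k hk

lemma exists_index_large_overlap (hp : 3 ≤ p) (hT : IsOdecoSVD T lam U)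
    (hX : IsOdecoSVD X lam' U') (hE : X = T + E) (hk : 0 < lam k)
    (hδ : spectralNorm E / lam k ≤ 1 / 100) :
    ∃ l, ∀ s, 4 / 5 < |inner ℝ (U' s l) (U s k)| := by
  have hD := sum_sq_prod_sub_overlap_le (by omega) hT hX hE hk
  have hδ0 : 0 ≤ spectralNorm E / lam k := div_nonneg
    (spectralNorm_nonneg (by omega) E (fun s => U s k) fun s => (hT.orthonormal s).norm_eq_one k)
    hk.le
  refine exists_large_overlap (x := fun l s => inner ℝ (U' s l) (U s k))
    (μ := fun l => lam' l / lam k) hp hδ (fun s => ?_)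
    (abs_overlap_sub_prod_le (by omega) hT hX hE hk) (fun l q => ?_) ⟨0, by omega⟩
    (one_sub_le_sum_prod_overlap (by omega) hT hX hE hk _)
  · simpa [(hT.orthonormal s).norm_eq_one] using sum_sq_inner_le (hX.orthonormal s) (U s k)
  · refine abs_le_of_sq_le_sq ?_ hδ0
    exact (single_le_sum (f := fun l => (lam' l / lam k *
      ∏ s ∈ univ.erase q, inner ℝ (U' s l) (U s k) - inner ℝ (U' q l) (U q k)) ^ 2)
      (fun _ _ => sq_nonneg _) (mem_univ l)).trans (hD q)

lemma sin_angle_le (hp : 3 ≤ p) (hT : IsOdecoSVD T lam U)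
    (hX : IsOdecoSVD X lam' U') (hE : X = T + E) (hk : 0 < lam k) {ε : ℝ} (hε : 0 < ε)
    (hε1 : ε ≤ 1) (hδ : spectralNorm E / lam k ≤ 1 / 100) (hδε : spectralNorm E / lam k ≤ ε / 8)
    {j : Fin (minDim d)} (hj : ∀ s, 4 / 5 < |inner ℝ (U' s j) (U s k)|) (q : Fin p) :
    Real.sin (InnerProductGeometry.angle (U' q j)
      (U q k + (lam k)⁻¹ • contractExcept E q (fun s => U s k))) ≤
        2 * ((1 + ε) * (spectralNorm E / lam k)) ^ (p - 1) := by
  have hnorm (s : Fin p) : ‖U s k‖ = 1 := (hT.orthonormal s).norm_eq_one k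
  have hδ0 : 0 ≤ spectralNorm E / lam k :=
    div_nonneg (spectralNorm_nonneg (by omega) E (fun s => U s k) hnorm) hk.le
  have hA := abs_overlap_sub_prod_le (by omega) hT hX hE hk
  have hD := sum_sq_prod_sub_overlap_le (by omega) hT hX hE hk
  have hx (s : Fin p) : ∑ l, inner ℝ (U' s l) (U s k) ^ 2 ≤ 1 := by
    simpa [hnorm s] using sum_sq_inner_le (hX.orthonormal s) (U s k)
  have hB (l q) : |lam' l / lam k * ∏ s ∈ univ.erase q, inner ℝ (U' s l) (U s k) -
      inner ℝ (U' q l) (U q k)| ≤ spectralNorm E / lam k := by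
    refine abs_le_of_sq_le_sq ?_ hδ0
    exact (single_le_sum (f := fun l => (lam' l / lam k *
      ∏ s ∈ univ.erase q, inner ℝ (U' s l) (U s k) - inner ℝ (U' q l) (U q k)) ^ 2)
      (fun _ _ => sq_nonneg _) (mem_univ l)).trans (hD q)
  have hsmall : ∀ l ≠ j, ∀ s, |inner ℝ (U' s l) (U s k)| ≤ 2 * (spectralNorm E / lam k) := by
    intro l hl
    refine (overlap_dichotomy hp hδ (fun s => ?_) (hA l) (hB l)).resolve_right fun h => ?_
    · refine (abs_real_inner_le_norm _ _).trans ?_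
      rw [hnorm, (hX.orthonormal s).norm_eq_one, one_mul]
    · exact hl (eq_of_large_overlap (hX.orthonormal q) (hnorm q) (h q) (hj q))
  have hsum := sum_erase_sq_le (x := fun l s => inner ℝ (U' s l) (U s k))
    (μ := fun l => lam' l / lam k) hp hε hε1 hδ hδε hx hA hD hsmall q
  have hG0 : 0 ≤ ((1 + ε) * (spectralNorm E / lam k)) ^ (p - 1) := by positivity
  have hsqrt := Real.sqrt_le_iff.2 ⟨by positivity, hsum⟩
  have hv := one_sub_le_norm_add_smul_contractExcept (E := E) hT hk q
  rw [add_smul_contractExcept_eq_sum (by omega) hT hX hE hk.ne' q] at hv ⊢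
  rw [← sin_angle_mul_norm_of_eq_sum (hX.orthonormal q)] at hsqrt
  have hsin := InnerProductGeometry.sin_angle_nonneg (U' q j)
    (∑ l, (lam' l / lam k * ∏ s ∈ univ.erase q, inner ℝ (U' s l) (U s k)) • U' q l)
  -- The sine times the norm is at most `3 / 2 * G ^ (p - 1)` with `G = (1 + ε) * δ`, and the norm
  -- is at least `99 / 100`; the quotient is below `2 * G ^ (p - 1)`.
  nlinarith

end Perturbation

end Tensor

end RealTensor

theorem theorem1 :
    ∃ c : ℝ → ℝ, (∀ ε : ℝ, 0 < ε → 0 < c ε) ∧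
      ∀ (p : ℕ) (_hp : 3 ≤ p) (d : Fin p → ℕ) (T X E : RealTensor d)
        (lam lam' : Fin (RealTensor.minDim d) → ℝ)
        (U U' : ∀ q : Fin p, Fin (RealTensor.minDim d) → EuclideanSpace ℝ (Fin (d q))),
        RealTensor.IsOdecoSVD T lam U →
        RealTensor.IsOdecoSVD X lam' U' →
        X = T + E →
        ∃ π : Equiv.Perm (Fin (RealTensor.minDim d)),
          ∀ ε : ℝ, 0 < ε → ∀ k : Fin (RealTensor.minDim d), 0 < lam k →
            RealTensor.spectralNorm E ≤ c ε * lam k →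
            ∀ q : Fin p,
              Real.sin (InnerProductGeometry.angle (U' q (π k))
                (U q k + (lam k)⁻¹ • RealTensor.contractExcept E q (fun s => U s k))) ≤
              (2 + RealTensor.spectralNorm E / lam k) *
                ((1 + ε) * RealTensor.spectralNorm E / lam k) ^ (p - 1) := by
  refine ⟨fun ε => min (1 / 100) (ε / 8), fun ε hε => by positivity, ?_⟩
  intro p hp d T X E lam lam' U U' hT hX hE
  -- The matching needs only the absolute threshold `1 / 100`, which makes `π` independent of `ε`.
  obtain ⟨π, hπ⟩ := RealTensor.exists_perm_matching
    (P := fun k => 0 < lam k ∧ RealTensor.spectralNorm E / lam k ≤ 1 / 100)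
    (R := fun k l => ∀ s, 4 / 5 < |inner ℝ (U' s l) (U s k)|)
    (fun k hk => RealTensor.exists_index_large_overlap hp hT hX hE hk.1 hk.2)
    (fun k k' l h h' => by
      have h := h ⟨0, by omega⟩
      have h' := h' ⟨0, by omega⟩
      rw [real_inner_comm] at h h'
      exact RealTensor.eq_of_large_overlap (hT.orthonormal _)
        ((hX.orthonormal _).norm_eq_one l) h h')
  refine ⟨π, fun ε hε k hk hEk q => ?_⟩
  rw [← div_le_iff₀ hk, le_min_iff] at hEk
  have hδ0 : 0 ≤ RealTensor.spectralNorm E / lam k :=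
    div_nonneg (RealTensor.spectralNorm_nonneg (by omega) E (fun s => U s k)
      fun s => (hT.orthonormal s).norm_eq_one k) hk.le
  -- `sin_angle_le` needs `ε ≤ 1`; capping is harmless because the bound increases with `ε`.
  refine (RealTensor.sin_angle_le hp hT hX hE hk (ε := min ε 1) (by positivity)
    (min_le_right _ _) hEk.1 ?_ (hπ k ⟨hk, hEk.1⟩) q).trans ?_
  · rcases min_cases ε 1 with h | h <;> rw [h.1] <;> linarith
  · rw [mul_div_assoc]
    gcongr
    · linarith
    · exact min_le_left _ _
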